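/- Consider $U(1)$-symmetric nonrelativistic bosons in vacuum in $d$ space dimensions, in the imaginary-time functional renormalization group. **Propagator.** For every scale $k>0$ let $G_k(x,y)$, with $x=(\tau_x,\mathbf x)$ and $y=(\tau_y,\mathbf y)$, be the regularized propagator, i.e. the Green function of $\partial_\tau-\nabla^2/(2M)-\mu+R_k$. The regulator $R_k$ is assumed to be such that $G_k$ is differentiable in $k$ and vanishes for $\tau_x\le\tau_y$. **Vertices.** Expand the interaction part of the flowing action (the flowing action minus the microscopic quadratic part) as $\sum_{q\ge1}(q!)^{-2}\int\Gamma_{k,q}(y_1,\dots,y_q;x_1,\dots,x_q)\,\phi^*(y_1)\cdots\phi^*(y_q)\,\phi(x_1)\cdots\phi(x_q)$, where each $q$-body vertex $\Gamma_{k,q}$ is a locally finite complex measure, symmetric in the outgoing points $y_i$ and in the incoming points $x_i$. (For a given $q$ these measures are taken to have densities with respect to a fixed $\sigma$-finite measure, which may charge coinciding points; $\Gamma_{k,1}$ is the self-energy.) The vertices obey the flow equation $$\partial_k\Gamma_k=\tfrac12\tilde\partial_k\operatorname{Tr}\log\bigl(\Gamma_k^{(2)}+R_k\bigr),$$ where $\tilde\partial_k$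 acts on $R_k$ only. Expanded in powers of the fields, this is a sum of one-loop diagrams with lines $G_k$, one of them replaced by $\partial_kG_k$. For $k\to\infty$ the vertices approach microscopic interactions of two or more bodies that are instantaneous (all times equal), and they are generated from these by the flow: for each $k$ they lie in the smallest class that contains the microscopic interactions and is closed under finite steps $\Gamma\mapsto\Gamma+\varepsilon\cdot(\text{right-hand side of the flow equation at some scale})$ and under weak limits. **Closeability.** A configuration of $q$ outgoing points $y_i$ and $q$ incoming points $x_i$ is *at least $j$-closeable* if $j$ distinct outgoing points can be paired with $j$ distinct incoming points such that $\tau_y<\tau_x$ in each pair, and *$j$-closeable* if it is at least $j$-closeable but not at least $(j+1)$-closeable. The (at least) $j$-closeable part of a vertex is its restriction to the (at least) $j$-closeable configurations. **Theorem (decoupling).** Let $n,m\ge0$ with $n+m\ge1$. The right-hand side of the flow equation for the $m$-closeable part of the $(n+m)$-body vertex depends only on 1. the regularized propagator $G_k$ and its scale derivative, 2. the $q$-body vertices with $2\le q\le n$, and 3. the at least $j$-closeable parts of the $(n+j)$-body vertices with $0<j\le m+1$. That is, the $m$-closeable part of the right-hand side at order $n+m$ is unchanged if all other vertices and parts of vertices,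 the self-energy included, are set to zero; and at equal $G_k$ and $k$ it coincides for any two families of vertices, each generated by the flow from some microscopic interactions, that agree in 2. and 3. -/

import Mathlib

open MeasureTheory Filter Topology
open scoped ContDiff

noncomputable section

namespace VacuumFRG

/-- Points `(τ, x)`: imaginary time and position in `d` space dimensions. -/
abbrev Pt (d : ℕ) : Type := ℝ × EuclideanSpace ℝ (Fin d)

/-- Positions of the legs of an `N`-body vertex: first the `N` outgoing legs (arguments of `φ*`),
then the `N` incoming legs (arguments of `φ`). -/
abbrev Legs (d N : ℕ) : Type := (Fin N → Pt d) × (Fin N → Pt d)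

/-- The unordered collection of the points of a tuple. -/
def pts {d N : ℕ} (y : Fin N → Pt d) : Multiset (Pt d) := Finset.univ.val.map y

/-- Functions of an unordered collection of outgoing and one of incoming points, i.e. functions
with the permutation symmetry of bosons. As a family of vertices, `Γ` restricted to collections
of `q` outgoing and `q` incoming points is the density of the `q`-body vertex, and the one-body
component is the deviation from the microscopic one (the self-energy). -/
abbrev BoseFun (d : ℕ) : Type := Multiset (Pt d) → Multiset (Pt d) → ℂ

/-- `m` outgoing legs can be joined with `m` incoming legs by lines that run strictly forward in
time (from the outgoing to the incoming leg). -/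
def IsCloseable {d : ℕ} (m : ℕ) (A B : Multiset (Pt d)) : Prop :=
  ∃ A' ≤ A, ∃ B' ≤ B, A'.card = m ∧ Multiset.Rel (fun y x => y.1 < x.1) A' B'

open Classical in
/-- The `m`-closeable part: the restriction to the time configurations in which `m`, but not
`m + 1`, pairs of legs can be closed. -/
def closeablePart {d : ℕ} (m : ℕ) (Γ : BoseFun d) : BoseFun d := fun A B =>
  if IsCloseable m A B ∧ ¬ IsCloseable (m + 1) A B then Γ A B else 0

open Classical in
/-- What remains of a family of vertices if one keeps only the `q`-body vertices with
`2 ≤ q ≤ n` and the at least `j`-closeable part of the `(n + j)`-body vertices with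
`0 < j ≤ m + 1`, and sets everything else to zero. -/
def relevantPart {d : ℕ} (n m : ℕ) (Γ : BoseFun d) : BoseFun d := fun A B =>
  if A.card = B.card ∧ ((2 ≤ A.card ∧ A.card ≤ n) ∨
      ∃ j, 0 < j ∧ j ≤ m + 1 ∧ A.card = n + j ∧ IsCloseable j A B)
  then Γ A B else 0

/-- Test functions for `N`-body vertices: bounded, measurable, of bounded support. -/
def IsTest {d : ℕ} (N : ℕ) (ψ : BoseFun d) : Prop :=
  Measurable (fun z : Legs d N => ψ (pts z.1) (pts z.2)) ∧
  (∃ C : ℝ, ∀ A B, ‖ψ A B‖ ≤ C) ∧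
  ∃ K : Set (Pt d), Bornology.IsBounded K ∧ ∀ A B, ψ A B ≠ 0 → ∀ x ∈ A + B, x ∈ K

/-- The `N`-body vertex is the measure with density `Γ` with respect to the reference measure
`ref N`, which may charge sets of coinciding legs (as it has to for instantaneous or contact
interactions). This predicate says that these measures are locally finite. -/
def IsVertexFamily {d : ℕ} (ref : ∀ N, Measure (Legs d N)) (Γ : BoseFun d) : Prop :=
  ∀ N, Measurable (fun z : Legs d N => Γ (pts z.1) (pts z.2)) ∧
    ∀ K : Set (Pt d), Bornology.IsBounded K →
      IntegrableOn (fun z : Legs d N => Γ (pts z.1) (pts z.2))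
        {z | ∀ i, z.1 i ∈ K ∧ z.2 i ∈ K} (ref N)

/-- The order-`(φ*φ)^N` part of the action, `(N!)⁻² ∫ Γ_N φ*⋯φ* φ⋯φ`, with a test function in
place of the product of fields. -/
def pairing {d : ℕ} (ref : ∀ N, Measure (Legs d N)) (N : ℕ) (Γ ψ : BoseFun d) : ℂ :=
  (1 / ((N.factorial : ℂ) ^ 2)) *
    ∫ z : Legs d N, Γ (pts z.1) (pts z.2) * ψ (pts z.1) (pts z.2) ∂(ref N)

/-- The transpose of the microscopic inverse propagator `∂_τ - ∇²/(2M) - μ`. -/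
def microTranspose {d : ℕ} (M μ : ℝ) (f : Pt d → ℂ) : Pt d → ℂ := fun x =>
  - deriv (fun s => f (s, x.2)) x.1
  - ((1 / (2 * M) : ℝ) : ℂ) * Laplacian.laplacian (fun v => f (x.1, v)) x.2
  - (μ : ℂ) * f x

/-- A regularization of nonrelativistic bosons in vacuum: a regulator `R_k`, given through its
transpose `RT k` on test functions, and the regularized propagator `G k x y = ⟨φ(x) φ*(y)⟩`, i.e.
the Green function of `∂_τ - ∇²/(2M) - μ + R_k`. The regulator is such that this propagator runs
only forward in time; it is taken to be zero at equal times. -/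
structure Regularization (d : ℕ) where
  M : ℝ
  μ : ℝ
  M_pos : 0 < M
  RT : ℝ → (Pt d → ℂ) →ₗ[ℂ] (Pt d → ℂ)
  G : ℝ → Pt d → Pt d → ℂ
  measurable_G : ∀ k, 0 < k → Measurable (fun p : Pt d × Pt d => G k p.1 p.2)
  green : ∀ k, 0 < k → ∀ f : Pt d → ℂ, ContDiff ℝ ∞ f → HasCompactSupport f → ∀ y,
    Integrable (fun x => G k x y * (microTranspose M μ f x + RT k f x)) ∧
      ∫ x, G k x y * (microTranspose M μ f x + RT k f x) = f y
  differentiable_G : ∀ k, 0 < k → ∀ x y, DifferentiableAt ℝ (fun κ => G κ x y) k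
  retarded : ∀ k, 0 < k → ∀ x y, x.1 ≤ y.1 → G k x y = 0

/-- The regulator scale derivative of the regularized propagator. -/
def Regularization.Gdot {d : ℕ} (P : Regularization d) (k : ℝ) (x y : Pt d) : ℂ :=
  deriv (fun κ => P.G κ x y) k

/-- The factor of an internal line that joins the leg `u` of one vertex with the leg `v` of
another (or the same) vertex; `Sum.inl` are outgoing and `Sum.inr` incoming legs. Only an
outgoing and an incoming leg can be joined. -/
def lineFactor {d q q' : ℕ} (g : Pt d → Pt d → ℂ) (z : Legs d q) (z' : Legs d q') :
    Fin q ⊕ Fin q → Fin q' ⊕ Fin q' → ℂ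
  | Sum.inl a, Sum.inr b => g (z'.2 b) (z.1 a)
  | Sum.inr b, Sum.inl a => g (z.2 b) (z'.1 a)
  | Sum.inl _, Sum.inl _ => 0
  | Sum.inr _, Sum.inr _ => 0

/-- The external outgoing points of a loop of vertices in which the legs `l i` and `ρ i` of the
vertex `i` are internal. -/
def extOut {d r : ℕ} {q : Fin r → ℕ} (l ρ : ∀ i, Fin (q i) ⊕ Fin (q i))
    (z : ∀ i, Legs d (q i)) : Multiset (Pt d) :=
  ∑ i, (Finset.univ.filter
    (fun a : Fin (q i) => Sum.inl a ≠ l i ∧ Sum.inl a ≠ ρ i)).val.map (z i).1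

/-- The external incoming points. -/
def extIn {d r : ℕ} {q : Fin r → ℕ} (l ρ : ∀ i, Fin (q i) ⊕ Fin (q i))
    (z : ∀ i, Legs d (q i)) : Multiset (Pt d) :=
  ∑ i, (Finset.univ.filter
    (fun b : Fin (q i) => Sum.inr b ≠ l i ∧ Sum.inr b ≠ ρ i)).val.map (z i).2

/-- A one-loop diagram with `r + 1` vertices of `q i` bodies: line `i` joins the leg `ρ i` of
vertex `i` with the leg `l (i + 1)` of vertex `i + 1` (cyclically), line `e` carries the scale
derivative of the propagator, and the external legs are paired with `ψ`. -/
def loopDiagram {d : ℕ} (P : Regularization d) (ref : ∀ N, Measure (Legs d N))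
    [∀ N, SigmaFinite (ref N)] (k : ℝ) (Γ ψ : BoseFun d) (r : ℕ) (q : Fin (r + 1) → ℕ)
    (l ρ : ∀ i, Fin (q i) ⊕ Fin (q i)) (e : Fin (r + 1)) : ℂ :=
  ∫ z : ∀ i, Legs d (q i),
    (∏ i, Γ (pts (z i).1) (pts (z i).2)) *
    (∏ i, lineFactor (if i = e then P.Gdot k else P.G k) (z i) (z (i + 1)) (ρ i) (l (i + 1))) *
    ψ (extOut l ρ z) (extIn l ρ z)
    ∂(Measure.pi fun i => ref (q i))

/-- The right-hand side of the flow equation, at order `(φ*φ)^N` in the fields and paired with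
`ψ`. This is the field expansion of `½ ∂̃_k Tr log (Γ_k^{(2)} + R_k)`, that is of
`∑_r (-1)^r / (2 (r + 1)) ∂̃_k Tr (G F)^{r+1}`, where `F` is the matrix of second functional
derivatives (with respect to `φ` and `φ*`) of `∑_q (q!)⁻² ∫ Γ_q φ*⋯φ* φ⋯φ` and `∂̃_k` acts on the
propagators `G`. The sum over `l`, `ρ` runs over the legs on which the two derivatives act. -/
def flowRHS {d : ℕ} (P : Regularization d) (ref : ∀ N, Measure (Legs d N))
    [∀ N, SigmaFinite (ref N)] (k : ℝ) (Γ : BoseFun d) (N : ℕ) (ψ : BoseFun d) : ℂ :=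
  ∑' r : ℕ, ((-1 : ℂ) ^ r / (2 * ((r : ℂ) + 1))) *
    ∑ q ∈ Finset.piAntidiag (Finset.univ : Finset (Fin (r + 1))) (N + (r + 1)),
      (∏ i, 1 / (((q i).factorial : ℂ) ^ 2)) *
        ∑ l : (∀ i, Fin (q i) ⊕ Fin (q i)), ∑ ρ : (∀ i, Fin (q i) ⊕ Fin (q i)),
          if ∀ i, l i ≠ ρ i then ∑ e, loopDiagram P ref k Γ ψ r q l ρ e else 0

/-- The interaction part of a microscopic action: instantaneous interactions of two or more
bodies. -/
structure IsMicroscopic {d : ℕ} (ref : ∀ N, Measure (Legs d N)) (S : BoseFun d) : Prop where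
  isVertexFamily : IsVertexFamily ref S
  instantaneous : ∀ A B, S A B ≠ 0 →
    A.card = B.card ∧ 2 ≤ A.card ∧ ∃ t : ℝ, ∀ x ∈ A + B, x.1 = t

/-- The families of vertices generated by the flow equation from the microscopic interactions
`S`: those obtained from `S` by finite steps of the flow and by limits. The solution of the flow
equation with microscopic data `S` is the limit of such steps (Euler polygons); an infinite
hierarchy of differential equations does not by itself determine its solution. -/
inductive FlowGenerated {d : ℕ} (P : Regularization d) (ref : ∀ N, Measure (Legs d N))
    [∀ N, SigmaFinite (ref N)] (S : BoseFun d) : BoseFun d → Prop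
  | micro : FlowGenerated P ref S S
  | step (Γ Γ' : BoseFun d) (k ε : ℝ) : 0 < k → FlowGenerated P ref S Γ → IsVertexFamily ref Γ' →
      (∀ N, 1 ≤ N → ∀ ψ, IsTest N ψ →
        pairing ref N Γ' ψ = pairing ref N Γ ψ + (ε : ℂ) * flowRHS P ref k Γ N ψ) →
      FlowGenerated P ref S Γ'
  | limit (Γs : ℕ → BoseFun d) (Γ : BoseFun d) : (∀ i, FlowGenerated P ref S (Γs i)) →
      IsVertexFamily ref Γ →
      (∀ N, 1 ≤ N → ∀ ψ, IsTest N ψ →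
        Tendsto (fun i => pairing ref N (Γs i) ψ) atTop (𝓝 (pairing ref N Γ ψ))) →
      FlowGenerated P ref S Γ

/-- `Γ` is the scale dependent family of one-particle irreducible vertices of the theory with
microscopic interactions `S`: it obeys the flow equation at every scale `k > 0`, approaches `S`
for `k → ∞`, and is generated from `S` by the flow. -/
structure IsFlow {d : ℕ} (P : Regularization d) (ref : ∀ N, Measure (Legs d N))
    [∀ N, SigmaFinite (ref N)] (S : BoseFun d) (Γ : ℝ → BoseFun d) : Prop where
  isMicroscopic : IsMicroscopic ref S
  generated : ∀ k, 0 < k → FlowGenerated P ref S (Γ k)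
  flow : ∀ N, 1 ≤ N → ∀ ψ, IsTest N ψ → ∀ k, 0 < k →
    HasDerivAt (fun κ => pairing ref N (Γ κ) ψ) (flowRHS P ref k (Γ k) N ψ) k
  initial : ∀ N, 1 ≤ N → ∀ ψ, IsTest N ψ →
    Tendsto (fun k => pairing ref N (Γ k) ψ) atTop (𝓝 (pairing ref N S ψ))

end VacuumFRG

end

/-! For a configuration, count the particles present at time `t`: incoming points up to `t` minus
outgoing points strictly before `t`. This occupation number is additive over vertices, and a line
from an outgoing point to a strictly later incoming point contributes at most zero to it. So closing
legs by retarded propagators can only raise it: at each time the occupation of the external legs of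
a loop is at least the sum over its vertices.

Closeability is dual to occupation: `N` incoming and `N` outgoing points are at least `m`-closeable
iff `m ≤ N` and the occupation never exceeds `N - m` (`isCloseable_iff`).

The flow preserves causality (`FlowGenerated.isCausallySupported`): outflow never exceeds inflow,
and at some time at least two particles are present. Microscopic interactions have this property,
loops inherit it, and it survives weak limits. It makes all vertex occupations nonnegative and
excludes the self-energy.

Now let the `n + m` external pairs of a loop be at least `m`-closeable. Their occupation is at most
`n`, hence so is that of each vertex, and by duality a `q`-body vertex with `q > n` is at least `(q
- n)`-closeable. Counting legs gives `q ≤ n + m + 1`. Hence only the listed parts occur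
(`relevantPart_eq_of_loop`). -/

namespace VacuumFRG

/-! ### Occupation numbers and their duality with closeability -/

section Occupation

variable {d : ℕ}

open Classical in
/-- The number of points of `B` that satisfy `p` minus the number of points of `A` that
satisfy `q`. -/
noncomputable def balance (p q : Pt d → Prop) (A B : Multiset (Pt d)) : ℤ :=
  (B.countP p : ℤ) - A.countP q

/-- The number of particles present at time `t`: incoming up to `t` minus outgoing before `t`. -/
noncomputable abbrev occupation (t : ℝ) (A B : Multiset (Pt d)) : ℤ :=
  balance (fun x => x.1 ≤ t) (fun y => y.1 < t) A B

/-- The number of particles still present immediately after time `t`. -/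
noncomputable abbrev netInflow (t : ℝ) (A B : Multiset (Pt d)) : ℤ :=
  balance (fun x => x.1 ≤ t) (fun y => y.1 ≤ t) A B

/-- At no time have more particles left than have entered, and at some time at least two
particles are present. -/
def IsCausal (A B : Multiset (Pt d)) : Prop :=
  (∀ t, 0 ≤ netInflow t A B) ∧ ∃ t, 2 ≤ occupation t A B

theorem balance_add (p q : Pt d → Prop) (A A' B B' : Multiset (Pt d)) :
    balance p q (A + A') (B + B') = balance p q A B + balance p q A' B' := by
  simp only [balance, Multiset.countP_add]
  push_cast
  ring

theorem balance_sum {ι : Type*} (p q : Pt d → Prop) (s : Finset ι)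
    (A B : ι → Multiset (Pt d)) :
    balance p q (∑ i ∈ s, A i) (∑ i ∈ s, B i) = ∑ i ∈ s, balance p q (A i) (B i) := by
  classical
  induction s using Finset.induction_on with
  | empty => simp [balance]
  | insert i s hi ih => rw [Finset.sum_insert hi, Finset.sum_insert hi, Finset.sum_insert hi,
      balance_add, ih]

theorem balance_singleton_nonpos {p q : Pt d → Prop} {y x : Pt d} (h : p x → q y) :
    balance p q {y} {x} ≤ 0 := by
  simp only [balance, ← Multiset.cons_zero, Multiset.countP_cons, Multiset.countP_zero]
  split_ifs <;> simp_all

/-- Each counted incoming end of a line is compensated by its earlier outgoing end. -/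
theorem balance_nonpos_of_rel {p q : Pt d → Prop} {A B : Multiset (Pt d)}
    (hpq : ∀ y x : Pt d, y.1 < x.1 → p x → q y)
    (h : Multiset.Rel (fun y x => y.1 < x.1) A B) : balance p q A B ≤ 0 := by
  induction h with
  | zero => simp [balance]
  | @cons a b as bs hab _ ih =>
    have := balance_singleton_nonpos (hpq a b hab)
    rw [← Multiset.singleton_add, ← Multiset.singleton_add, balance_add]
    omega

theorem balance_le_card (p q : Pt d → Prop) (A B : Multiset (Pt d)) :
    balance p q A B ≤ B.card := by
  classical
  have h : B.countP p ≤ B.card := Multiset.countP_le_card _ _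
  simp only [balance]
  omega

theorem countP_mono_of_imp {A : Multiset (Pt d)} {p q : Pt d → Prop} [DecidablePred p]
    [DecidablePred q] (h : ∀ x, p x → q x) : A.countP p ≤ A.countP q := by
  rw [Multiset.countP_eq_card_filter, Multiset.countP_eq_card_filter]
  exact Multiset.card_le_card (Multiset.monotone_filter_right _ h)

theorem netInflow_le_occupation (t : ℝ) (A B : Multiset (Pt d)) :
    netInflow t A B ≤ occupation t A B := by
  classical
  have h : A.countP (fun y => y.1 < t) ≤ A.countP (fun y => y.1 ≤ t) :=
    countP_mono_of_imp fun y hy => le_of_lt hy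
  simp only [netInflow, occupation, balance]
  omega

theorem IsCausal.occupation_nonneg {A B : Multiset (Pt d)} (h : IsCausal A B) (t : ℝ) :
    0 ≤ occupation t A B :=
  (h.1 t).trans (netInflow_le_occupation t A B)

/-- This is what excludes the self-energy from every loop. -/
theorem IsCausal.two_le_card {A B : Multiset (Pt d)} (h : IsCausal A B) : 2 ≤ B.card := by
  obtain ⟨t, ht⟩ := h.2
  exact_mod_cast ht.trans (balance_le_card _ _ A B)

theorem card_pts {N : ℕ} (y : Fin N → Pt d) : (pts y).card = N := by
  simp [pts]

theorem mem_pts {N : ℕ} {y : Fin N → Pt d} {x : Pt d} : x ∈ pts y ↔ ∃ i, y i = x := by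
  simp only [pts, Multiset.mem_map, Finset.mem_val, Finset.mem_univ, true_and]

theorem exists_eq_pts {N : ℕ} {A : Multiset (Pt d)} (h : A.card = N) :
    ∃ y : Fin N → Pt d, Monotone (fun i => (y i).1) ∧ pts y = A := by
  obtain ⟨L, rfl⟩ := Quot.exists_rep A
  have hL : L.length = N := h
  subst hL
  refine ⟨L.get ∘ Tuple.sort (fun i => (L.get i).1),
    Tuple.monotone_sort (fun i => (L.get i).1), ?_⟩
  rw [pts, ← Multiset.map_map, Multiset.map_univ_val_equiv, Fin.univ_val_map, List.ofFn_get]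
  rfl

theorem countP_pts {N : ℕ} (p : Pt d → Prop) [DecidablePred p] (y : Fin N → Pt d) :
    (pts y).countP p = (Finset.univ.filter fun i => p (y i)).card := by
  rw [pts, Multiset.countP_map]
  rfl

/-- The `m` closed pairs contribute at most zero to the occupation, and the remaining incoming
points at most their number. -/
theorem IsCloseable.occupation_le {m : ℕ} {A B : Multiset (Pt d)} (h : IsCloseable m A B)
    (t : ℝ) : occupation t A B + m ≤ B.card := by
  obtain ⟨A', hA, B', hB, hm, hrel⟩ := h
  obtain ⟨A'', rfl⟩ := Multiset.le_iff_exists_add.1 hA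
  obtain ⟨B'', rfl⟩ := Multiset.le_iff_exists_add.1 hB
  have h1 := balance_nonpos_of_rel (p := fun x => x.1 ≤ t) (q := fun y => y.1 < t)
    (fun y x hyx hx => hyx.trans_le hx) hrel
  have h2 := balance_le_card (fun x => x.1 ≤ t) (fun y => y.1 < t) A'' B''
  have h3 := Multiset.card_eq_card_of_rel hrel
  simp only [occupation, balance_add, Multiset.card_add]
  push_cast
  omega

/-- If at most `N - m` particles are present at any time, the `m` earliest outgoing points can be
joined with the `m` latest incoming ones. -/
theorem isCloseable_of_occupation_le {m : ℕ} {A B : Multiset (Pt d)} (hAB : A.card = B.card)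
    (hm : m ≤ B.card) (h : ∀ t, occupation t A B + m ≤ B.card) : IsCloseable m A B := by
  classical
  obtain ⟨N, hN⟩ : ∃ N, N = B.card := ⟨_, rfl⟩
  obtain ⟨y, hy, rfl⟩ := exists_eq_pts (hAB.trans hN.symm)
  obtain ⟨x, hx, rfl⟩ := exists_eq_pts hN.symm
  rw [← hN] at hm h
  let f : Fin m → Fin N := fun i => ⟨i, i.2.trans_le hm⟩
  let g : Fin m → Fin N := fun i => ⟨N - m + i, by omega⟩
  have hf : Function.Injective f := fun i j hij => by
    have := congrArg Fin.val hij; exact Fin.ext this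
  have hg : Function.Injective g := fun i j hij => by
    have : N - m + i.1 = N - m + j.1 := congrArg Fin.val hij
    exact Fin.ext (by omega)
  have hle : ∀ {e : Fin m → Fin N}, Function.Injective e →
      (Finset.univ : Finset (Fin m)).val.map e ≤ (Finset.univ : Finset (Fin N)).val :=
    fun {e} he => Finset.val_le_iff.2 (Finset.subset_univ (Finset.univ.map ⟨e, he⟩))
  refine ⟨Finset.univ.val.map (y ∘ f), ?_, Finset.univ.val.map (x ∘ g), ?_, by simp, ?_⟩
  · rw [← Multiset.map_map]; exact Multiset.map_le_map (hle hf)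
  · rw [← Multiset.map_map]; exact Multiset.map_le_map (hle hg)
  rw [Multiset.rel_map]
  refine Multiset.rel_refl_of_refl_on fun i _ => ?_
  by_contra hi
  -- If pair `i` fails, take the time of its incoming point. By the sorting, at least `N - m + i +
  -- 1` particles have entered by then and at most `i` have left before, so the occupation exceeds
  -- `N - m`.
  have hi : (x (g i)).1 ≤ (y (f i)).1 := not_lt.1 hi
  have ht := h (x (g i)).1
  have hB : N - m + i + 1 ≤ (Finset.univ.filter fun b => (x b).1 ≤ (x (g i)).1).card := by
    calc N - m + i + 1 = (Finset.Iic (g i)).card := by rw [Fin.card_Iic]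
      _ ≤ _ := Finset.card_le_card fun b hb => by
        simpa using hx (Finset.mem_Iic.1 hb)
  have hA : (Finset.univ.filter fun a => (y a).1 < (x (g i)).1).card ≤ i := by
    calc _ ≤ (Finset.Iio (f i)).card := Finset.card_le_card fun a ha => by
          rw [Finset.mem_Iio]
          by_contra hfa
          have h1 := hy (not_lt.1 hfa)
          have h2 := (Finset.mem_filter.1 ha).2
          exact absurd (hi.trans h1) (not_le.2 h2)
      _ = i := by rw [Fin.card_Iio]
  simp only [occupation, balance, countP_pts] at ht
  omega

theorem isCloseable_iff {m : ℕ} {A B : Multiset (Pt d)} (hAB : A.card = B.card) :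
    IsCloseable m A B ↔ m ≤ B.card ∧ ¬ ∃ t, (B.card : ℤ) - m + 1 ≤ occupation t A B := by
  constructor
  · intro h
    refine ⟨?_, fun ⟨t, ht⟩ => ?_⟩
    · obtain ⟨A', hA, B', hB, hm, -⟩ := h
      rw [← hm, ← hAB]
      exact Multiset.card_le_card hA
    · have := h.occupation_le t
      omega
  · rintro ⟨hm, h⟩
    refine isCloseable_of_occupation_le hAB hm fun t => ?_
    by_contra ht
    exact h ⟨t, by omega⟩

open Classical in
-- Take for `s` a latest point up to `t`. This reduces conditions on all real times to the finitely
-- many times of the points, which yields measurability.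
theorem exists_countP_le_eq {A : Multiset (Pt d)} {t : ℝ}
    (h : 0 < A.countP (fun x => x.1 ≤ t)) :
    ∃ s ∈ A, s.1 ≤ t ∧ A.countP (fun x => x.1 ≤ s.1) = A.countP (fun x => x.1 ≤ t) := by
  obtain ⟨a, ha, hat⟩ := Multiset.countP_pos.1 h
  obtain ⟨s, hs, hmax⟩ := Finset.exists_max_image (A.toFinset.filter fun x => x.1 ≤ t)
    (fun x => x.1) ⟨a, by simp [ha, hat]⟩
  simp only [Finset.mem_filter, Multiset.mem_toFinset] at hs hmax
  refine ⟨s, hs.1, hs.2, Multiset.countP_congr rfl fun x hx => ?_⟩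
  exact propext ⟨fun hxs => hxs.trans hs.2, fun hxt => hmax x ⟨hx, hxt⟩⟩

/-- The net inflow starts at zero and drops only at outgoing points. -/
theorem forall_netInflow_nonneg_iff {A B : Multiset (Pt d)} :
    (∀ t, 0 ≤ netInflow t A B) ↔ ∀ s ∈ A, 0 ≤ netInflow s.1 A B := by
  classical
  refine ⟨fun h s _ => h s.1, fun h t => ?_⟩
  rcases Nat.eq_zero_or_pos (A.countP (fun x => x.1 ≤ t)) with h0 | h0
  · simp only [netInflow, balance]
    omega
  · obtain ⟨s, hs, hst, heq⟩ := exists_countP_le_eq h0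
    have h1 := h s hs
    have h2 : B.countP (fun x => x.1 ≤ s.1) ≤ B.countP (fun x => x.1 ≤ t) :=
      countP_mono_of_imp fun x hx => hx.trans hst
    simp only [netInflow, balance] at h1 ⊢
    omega

/-- The occupation rises only at incoming points, and a positive value needs at least one of them.
-/
theorem exists_le_occupation_iff {c : ℤ} (hc : 0 < c) {A B : Multiset (Pt d)} :
    (∃ t, c ≤ occupation t A B) ↔ ∃ s ∈ B, c ≤ occupation s.1 A B := by
  classical
  refine ⟨fun ⟨t, h⟩ => ?_, fun ⟨s, _, h⟩ => ⟨s.1, h⟩⟩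
  have h0 : 0 < B.countP (fun x => x.1 ≤ t) := by
    simp only [occupation, balance] at h
    omega
  obtain ⟨s, hs, hst, heq⟩ := exists_countP_le_eq h0
  have h2 : A.countP (fun x => x.1 < s.1) ≤ A.countP (fun x => x.1 < t) :=
    countP_mono_of_imp fun x hx => lt_of_lt_of_le hx hst
  refine ⟨s, hs, ?_⟩
  simp only [occupation, balance] at h ⊢
  omega

/-- An instantaneous configuration of two or more bodies is causal. -/
theorem isCausal_of_instantaneous {A B : Multiset (Pt d)} (hAB : A.card = B.card)
    (h2 : 2 ≤ A.card) {t : ℝ} (ht : ∀ x ∈ A + B, x.1 = t) : IsCausal A B := by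
  classical
  have hA : ∀ x ∈ A, x.1 = t := fun x hx => ht x (Multiset.mem_add.2 (Or.inl hx))
  have hB : ∀ x ∈ B, x.1 = t := fun x hx => ht x (Multiset.mem_add.2 (Or.inr hx))
  refine ⟨fun s => ?_, t, ?_⟩
  · simp only [netInflow, balance]
    by_cases hts : t ≤ s
    · rw [Multiset.countP_eq_card.2 fun x hx => (hB x hx).le.trans hts,
        Multiset.countP_eq_card.2 fun x hx => (hA x hx).le.trans hts, hAB, sub_self]
    · rw [(Multiset.countP_eq_zero (s := A)).2 fun x hx => by rwa [hA x hx]]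
      simp
  · simp only [occupation, balance]
    rw [Multiset.countP_eq_card.2 fun x hx => (hB x hx).le,
      Multiset.countP_eq_zero.2 fun x hx => by rw [hA x hx]; exact lt_irrefl t]
    omega

end Occupation

/-! ### Measurability of the closeable and the causal configurations -/

section Measurability

variable {d N : ℕ}

theorem measurable_balance {p q : Legs d N → Pt d → Prop}
    (hp : ∀ i, MeasurableSet {z : Legs d N | p z (z.2 i)})
    (hq : ∀ i, MeasurableSet {z : Legs d N | q z (z.1 i)}) :
    Measurable fun z : Legs d N => balance (p z) (q z) (pts z.1) (pts z.2) := by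
  classical
  simp only [balance, countP_pts, Finset.card_filter]
  push_cast
  exact (Finset.measurable_sum _ fun i _ =>
      Measurable.ite (hp i) measurable_const measurable_const).sub
    (Finset.measurable_sum _ fun i _ =>
      Measurable.ite (hq i) measurable_const measurable_const)

theorem measurable_time_out (i : Fin N) : Measurable fun z : Legs d N => (z.1 i).1 := by
  fun_prop

theorem measurable_time_in (i : Fin N) : Measurable fun z : Legs d N => (z.2 i).1 := by
  fun_prop

theorem measurableSet_exists_le_occupation {c : ℤ} (hc : 0 < c) :
    MeasurableSet {z : Legs d N | ∃ t, c ≤ occupation t (pts z.1) (pts z.2)} := by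
  simp only [exists_le_occupation_iff hc, mem_pts, exists_exists_eq_and]
  rw [Set.ofPred_exists]
  refine MeasurableSet.iUnion fun b => ?_
  exact measurableSet_le measurable_const (measurable_balance
    (fun i => measurableSet_le (measurable_time_in i) (measurable_time_in b))
    (fun i => measurableSet_lt (measurable_time_out i) (measurable_time_in b)))

theorem measurableSet_isCloseable (m : ℕ) :
    MeasurableSet {z : Legs d N | IsCloseable m (pts z.1) (pts z.2)} := by
  by_cases hm : m ≤ N
  · simp only [isCloseable_iff ((card_pts _).trans (card_pts _).symm), card_pts, hm, true_and]
    exact (measurableSet_exists_le_occupation (by omega)).compl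
  · simp only [isCloseable_iff ((card_pts _).trans (card_pts _).symm), card_pts, hm, false_and]
    exact MeasurableSet.const False

theorem measurableSet_isCausal :
    MeasurableSet {z : Legs d N | IsCausal (pts z.1) (pts z.2)} := by
  simp only [IsCausal, forall_netInflow_nonneg_iff, mem_pts, forall_exists_index,
    forall_apply_eq_imp_iff]
  rw [Set.ofPred_and, Set.ofPred_forall]
  refine (MeasurableSet.iInter fun a => ?_).inter (measurableSet_exists_le_occupation two_pos)
  exact measurableSet_le measurable_const (measurable_balance
    (fun i => measurableSet_le (measurable_time_in i) (measurable_time_out a))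
    (fun i => measurableSet_le (measurable_time_out i) (measurable_time_out a)))

end Measurability

end VacuumFRG

namespace VacuumFRG

/-! ### Particle counting in one-loop diagrams -/

section Loop

variable {d : ℕ}

/-- The point of an outgoing leg, as a multiset that is empty for incoming legs. -/
def outPoint {q : ℕ} (z : Legs d q) : Fin q ⊕ Fin q → Multiset (Pt d)
  | Sum.inl a => {z.1 a}
  | Sum.inr _ => 0

/-- The point of an incoming leg, as a multiset that is empty for outgoing legs. -/
def inPoint {q : ℕ} (z : Legs d q) : Fin q ⊕ Fin q → Multiset (Pt d)
  | Sum.inl _ => 0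
  | Sum.inr b => {z.2 b}

theorem map_filter_ne_add {α β : Type*} [DecidableEq α] (s : Multiset α) (hs : s.Nodup)
    (f : α → β) (a : α) (ha : a ∈ s) :
    (s.filter (¬ · = a)).map f + {f a} = s.map f := by
  rw [← hs.erase_eq_filter, add_comm, Multiset.singleton_add, ← Multiset.map_cons,
    Multiset.cons_erase ha]

theorem map_filter_add_outPoint {q : ℕ} (z : Legs d q) {l ρ : Fin q ⊕ Fin q} (h : l ≠ ρ) :
    (Finset.univ.filter (fun a : Fin q => Sum.inl a ≠ l ∧ Sum.inl a ≠ ρ)).val.map z.1 +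
      (outPoint z l + outPoint z ρ) = pts z.1 := by
  have hu := (Finset.univ : Finset (Fin q)).nodup
  rcases l with a | b <;> rcases ρ with a' | b' <;>
    simp only [outPoint, pts, Finset.filter_val, ne_eq, Sum.inl.injEq, reduceCtorEq,
      not_false_eq_true, and_true, true_and, add_zero, zero_add, Multiset.filter_true]
  · have hne : a ≠ a' := fun e => h (by rw [e])
    rw [← add_assoc, ← Multiset.filter_filter,
      map_filter_ne_add _ (hu.filter _) z.1 a (by simpa using hne),
      map_filter_ne_add _ hu z.1 a' (Finset.mem_univ a')]
  · exact map_filter_ne_add _ hu z.1 a (Finset.mem_univ a)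
  · exact map_filter_ne_add _ hu z.1 a' (Finset.mem_univ a')

theorem map_filter_add_inPoint {q : ℕ} (z : Legs d q) {l ρ : Fin q ⊕ Fin q} (h : l ≠ ρ) :
    (Finset.univ.filter (fun b : Fin q => Sum.inr b ≠ l ∧ Sum.inr b ≠ ρ)).val.map z.2 +
      (inPoint z l + inPoint z ρ) = pts z.2 := by
  -- Exchanging the two kinds of legs reduces the claim to the outgoing case.
  have h' : Sum.swap l ≠ Sum.swap ρ := fun e => h (Sum.swap_leftInverse.injective e)
  have key := map_filter_add_outPoint (Prod.swap z) h'
  rcases l with a | b <;> rcases ρ with a' | b' <;>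
    simpa [outPoint, inPoint] using key

theorem exists_points_of_lineFactor_ne_zero {q q' : ℕ} {g : Pt d → Pt d → ℂ}
    (hg : ∀ x y, x.1 ≤ y.1 → g x y = 0) {z : Legs d q} {z' : Legs d q'}
    {u : Fin q ⊕ Fin q} {v : Fin q' ⊕ Fin q'} (h : lineFactor g z z' u v ≠ 0) :
    ∃ y x : Pt d, y.1 < x.1 ∧ outPoint z u + outPoint z' v = {y} ∧
      inPoint z u + inPoint z' v = {x} := by
  rcases u with a | b <;> rcases v with a' | b' <;> simp only [lineFactor] at h
  · exact absurd rfl h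
  · exact ⟨z.1 a, z'.2 b', not_le.1 fun hle => h (hg _ _ hle), by simp [outPoint],
      by simp [inPoint]⟩
  · exact ⟨z'.1 a', z.2 b, not_le.1 fun hle => h (hg _ _ hle), by simp [outPoint],
      by simp [inPoint]⟩
  · exact absurd rfl h

/-- The propagator vanishes there at all positive scales, hence in a neighbourhood of `k`. -/
theorem Regularization.Gdot_retarded (P : Regularization d) {k : ℝ} (hk : 0 < k) (x y : Pt d)
    (h : x.1 ≤ y.1) : P.Gdot k x y = 0 := by
  have : (fun κ => P.G κ x y) =ᶠ[𝓝 k] fun _ => 0 := by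
    filter_upwards [lt_mem_nhds hk] with κ hκ using P.retarded κ hκ x y h
  rw [Regularization.Gdot, this.deriv_eq, deriv_const]

/-- The internal lines of a loop, if none of their factors vanishes. -/
theorem exists_lines {r : ℕ} {q : Fin (r + 1) → ℕ} {l ρ : ∀ i, Fin (q i) ⊕ Fin (q i)}
    (hlρ : ∀ i, l i ≠ ρ i) {g : Fin (r + 1) → Pt d → Pt d → ℂ}
    (hg : ∀ i x y, x.1 ≤ y.1 → g i x y = 0) {z : ∀ i, Legs d (q i)}
    (h : ∀ i, lineFactor (g i) (z i) (z (i + 1)) (ρ i) (l (i + 1)) ≠ 0) :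
    ∃ y x : Fin (r + 1) → Pt d, (∀ i, (y i).1 < (x i).1) ∧
      extOut l ρ z + ∑ i, {y i} = ∑ i, pts (z i).1 ∧
      extIn l ρ z + ∑ i, {x i} = ∑ i, pts (z i).2 := by
  choose y x hyx hy hx using fun i => exists_points_of_lineFactor_ne_zero (hg i) (h i)
  refine ⟨y, x, hyx, ?_, ?_⟩
  · have h1 : ∑ i, ({y i} : Multiset (Pt d)) =
        ∑ i, (outPoint (z i) (l i) + outPoint (z i) (ρ i)) := by
      simp_rw [← hy, Finset.sum_add_distrib]
      -- Line `i` ends on vertex `i + 1`, so the left ends are reindexed by the cyclic shift.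
      rw [add_comm, ← Equiv.sum_comp (Equiv.addRight (1 : Fin (r + 1)))
        (fun i => outPoint (z i) (l i))]
      rfl
    rw [h1, extOut, ← Finset.sum_add_distrib]
    exact Finset.sum_congr rfl fun i _ => map_filter_add_outPoint (z i) (hlρ i)
  · have h1 : ∑ i, ({x i} : Multiset (Pt d)) =
        ∑ i, (inPoint (z i) (l i) + inPoint (z i) (ρ i)) := by
      simp_rw [← hx, Finset.sum_add_distrib]
      rw [add_comm, ← Equiv.sum_comp (Equiv.addRight (1 : Fin (r + 1)))
        (fun i => inPoint (z i) (l i))]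
      rfl
    rw [h1, extIn, ← Finset.sum_add_distrib]
    exact Finset.sum_congr rfl fun i _ => map_filter_add_inPoint (z i) (hlρ i)

/-- Closing legs by lines that run forward in time can only increase the particle number. -/
theorem sum_balance_le_balance_ext {r : ℕ} {q : Fin (r + 1) → ℕ}
    {l ρ : ∀ i, Fin (q i) ⊕ Fin (q i)} (hlρ : ∀ i, l i ≠ ρ i)
    {g : Fin (r + 1) → Pt d → Pt d → ℂ}
    (hg : ∀ i x y, x.1 ≤ y.1 → g i x y = 0) {z : ∀ i, Legs d (q i)}
    (h : ∀ i, lineFactor (g i) (z i) (z (i + 1)) (ρ i) (l (i + 1)) ≠ 0)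
    {p p' : Pt d → Prop} (hpp' : ∀ y x : Pt d, y.1 < x.1 → p x → p' y) :
    ∑ i, balance p p' (pts (z i).1) (pts (z i).2) ≤
      balance p p' (extOut l ρ z) (extIn l ρ z) := by
  obtain ⟨y, x, hyx, hy, hx⟩ := exists_lines hlρ hg h
  have h1 : ∑ i, balance p p' {y i} {x i} ≤ 0 :=
    Finset.sum_nonpos fun i _ => balance_singleton_nonpos (hpp' _ _ (hyx i))
  rw [← balance_sum, ← hy, ← hx, balance_add, balance_sum]
  omega

/-- No vertex of a loop of causal vertices has more particles present than the whole loop. -/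
theorem occupation_le_occupation_ext {r : ℕ} {q : Fin (r + 1) → ℕ}
    {l ρ : ∀ i, Fin (q i) ⊕ Fin (q i)} (hlρ : ∀ i, l i ≠ ρ i)
    {g : Fin (r + 1) → Pt d → Pt d → ℂ}
    (hg : ∀ i x y, x.1 ≤ y.1 → g i x y = 0) {z : ∀ i, Legs d (q i)}
    (h : ∀ i, lineFactor (g i) (z i) (z (i + 1)) (ρ i) (l (i + 1)) ≠ 0)
    (hz : ∀ i, IsCausal (pts (z i).1) (pts (z i).2)) (i : Fin (r + 1)) (t : ℝ) :
    occupation t (pts (z i).1) (pts (z i).2) ≤ occupation t (extOut l ρ z) (extIn l ρ z) :=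
  (Finset.single_le_sum (f := fun i => occupation t (pts (z i).1) (pts (z i).2))
    (fun j _ => (hz j).occupation_nonneg t) (Finset.mem_univ i)).trans
    (sum_balance_le_balance_ext hlρ hg h fun _ _ hyx hx => lt_of_lt_of_le hyx hx)

/-- Net inflows add and lines only raise them; a time with two particles at vertex `0` is one for
the whole loop. -/
theorem isCausal_ext {r : ℕ} {q : Fin (r + 1) → ℕ}
    {l ρ : ∀ i, Fin (q i) ⊕ Fin (q i)} (hlρ : ∀ i, l i ≠ ρ i)
    {g : Fin (r + 1) → Pt d → Pt d → ℂ}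
    (hg : ∀ i x y, x.1 ≤ y.1 → g i x y = 0) {z : ∀ i, Legs d (q i)}
    (h : ∀ i, lineFactor (g i) (z i) (z (i + 1)) (ρ i) (l (i + 1)) ≠ 0)
    (hz : ∀ i, IsCausal (pts (z i).1) (pts (z i).2)) :
    IsCausal (extOut l ρ z) (extIn l ρ z) := by
  refine ⟨fun t => ?_, ?_⟩
  · exact (Finset.sum_nonneg fun i _ => (hz i).1 t).trans
      (sum_balance_le_balance_ext hlρ hg h fun _ _ hyx hx => hyx.le.trans hx)
  · obtain ⟨t, ht⟩ := (hz 0).2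
    exact ⟨t, ht.trans (occupation_le_occupation_ext hlρ hg h hz 0 t)⟩

theorem card_extIn {r N : ℕ} {q : Fin (r + 1) → ℕ}
    {l ρ : ∀ i, Fin (q i) ⊕ Fin (q i)} (hlρ : ∀ i, l i ≠ ρ i)
    {g : Fin (r + 1) → Pt d → Pt d → ℂ}
    (hg : ∀ i x y, x.1 ≤ y.1 → g i x y = 0) {z : ∀ i, Legs d (q i)}
    (h : ∀ i, lineFactor (g i) (z i) (z (i + 1)) (ρ i) (l (i + 1)) ≠ 0)
    (hq : ∑ i, q i = N + (r + 1)) : (extIn l ρ z).card = N := by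
  obtain ⟨y, x, -, -, hx⟩ := exists_lines hlρ hg h
  have := congrArg Multiset.card hx
  simp only [Multiset.card_add, Multiset.card_sum, card_pts, Multiset.card_singleton,
    Finset.sum_const, Finset.card_univ, Fintype.card_fin, hq, smul_eq_mul, mul_one] at this
  omega

/-- In a loop of causal vertices whose external legs are at least `m`-closeable, each vertex is
among those kept by `relevantPart n m`. -/
theorem relevantPart_eq_of_loop {n m r : ℕ} {q : Fin (r + 1) → ℕ}
    {l ρ : ∀ i, Fin (q i) ⊕ Fin (q i)} (hlρ : ∀ i, l i ≠ ρ i)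
    {g : Fin (r + 1) → Pt d → Pt d → ℂ}
    (hg : ∀ i x y, x.1 ≤ y.1 → g i x y = 0) {z : ∀ i, Legs d (q i)}
    (h : ∀ i, lineFactor (g i) (z i) (z (i + 1)) (ρ i) (l (i + 1)) ≠ 0)
    (hz : ∀ i, IsCausal (pts (z i).1) (pts (z i).2))
    (hq : ∑ i, q i = n + m + (r + 1)) (hm : IsCloseable m (extOut l ρ z) (extIn l ρ z))
    (Γ : BoseFun d) (i : Fin (r + 1)) :
    relevantPart n m Γ (pts (z i).1) (pts (z i).2) = Γ (pts (z i).1) (pts (z i).2) := by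
  have h2 : ∀ j, 2 ≤ q j := fun j => by simpa only [card_pts] using (hz j).two_le_card
  -- Each of the other `r` vertices uses up at least one of the `n + m + r + 1` bodies.
  have hle : q i ≤ n + m + 1 := by
    have h1 : ∑ j ∈ Finset.univ.erase i, 1 ≤ ∑ j ∈ Finset.univ.erase i, q j :=
      Finset.sum_le_sum fun j _ => (h2 j).trans' one_le_two
    have h3 := Finset.add_sum_erase Finset.univ q (Finset.mem_univ i)
    simp only [Finset.sum_const, Finset.card_erase_of_mem (Finset.mem_univ i),
      Finset.card_univ, Fintype.card_fin, smul_eq_mul, mul_one] at h1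
    omega
  refine if_pos ⟨(card_pts _).trans (card_pts _).symm, ?_⟩
  rw [card_pts]
  by_cases hn : q i ≤ n
  · exact Or.inl ⟨h2 i, hn⟩
  · refine Or.inr ⟨q i - n, by omega, by omega, by omega, ?_⟩
    refine isCloseable_of_occupation_le ((card_pts _).trans (card_pts _).symm)
      (by rw [card_pts]; omega) fun t => ?_
    -- The external occupation is at most `n`, which equals `q i - j` for `j = q i - n`.
    have h4 := hm.occupation_le t
    have h5 := occupation_le_occupation_ext hlρ hg h hz i t
    rw [card_extIn hlρ hg h hq] at h4
    rw [card_pts]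
    push_cast [Nat.cast_sub (not_le.1 hn).le] at h4 ⊢
    linarith

end Loop

end VacuumFRG

namespace VacuumFRG

/-! ### Causal support along the flow and the reduction to relevant parts -/

section Flow

variable {d : ℕ}

/-- The vertices of one or more bodies vanish almost everywhere outside the causal
configurations. -/
def IsCausallySupported (ref : ∀ N, Measure (Legs d N)) (Γ : BoseFun d) : Prop :=
  ∀ N, 1 ≤ N → ∀ᵐ z ∂(ref N), Γ (pts z.1) (pts z.2) ≠ 0 → IsCausal (pts z.1) (pts z.2)

theorem one_le_of_leg {q : ℕ} (u : Fin q ⊕ Fin q) : 1 ≤ q := by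
  rcases u with a | a <;> exact Nat.one_le_of_lt a.2

variable {ref : ∀ N, Measure (Legs d N)}

/-- A vertex that vanishes on all test functions without causal configurations in their support
is causally supported. -/
theorem ae_isCausal_of_pairing_eq_zero {Γ : BoseFun d} (hΓ : IsVertexFamily ref Γ) {N : ℕ}
    (h : ∀ ψ, IsTest N ψ → (∀ A B, ψ A B ≠ 0 → ¬ IsCausal A B) → pairing ref N Γ ψ = 0) :
    ∀ᵐ z ∂(ref N), Γ (pts z.1) (pts z.2) ≠ 0 → IsCausal (pts z.1) (pts z.2) := by
  classical
  obtain ⟨hmeas, hint⟩ := hΓ N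
  let ball : ℕ → Set (Pt d) := fun R => Metric.closedBall 0 R
  -- Testing with the conjugate of `Γ` on the noncausal set gives the integral of a square. The
  -- truncation in size and position makes it an admissible test function, and `R → ∞` removes it.
  let good : ℕ → Multiset (Pt d) → Multiset (Pt d) → Prop := fun R A B =>
    ¬ IsCausal A B ∧ ‖Γ A B‖ ≤ R ∧ ∀ x ∈ A + B, x ∈ ball R
  let ψ : ℕ → BoseFun d := fun R A B => if good R A B then starRingEnd ℂ (Γ A B) else 0
  have hball : ∀ (R : ℕ) (z : Legs d N), (∀ x ∈ pts z.1 + pts z.2, x ∈ ball R) ↔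
      ∀ i, z.1 i ∈ ball R ∧ z.2 i ∈ ball R := by
    intro R z
    simp only [Multiset.mem_add, mem_pts]
    constructor
    · exact fun H i => ⟨H _ (Or.inl ⟨i, rfl⟩), H _ (Or.inr ⟨i, rfl⟩)⟩
    · rintro H x (⟨i, rfl⟩ | ⟨i, rfl⟩)
      exacts [(H i).1, (H i).2]
  have hballmeas : ∀ R, MeasurableSet {z : Legs d N | ∀ i, z.1 i ∈ ball R ∧ z.2 i ∈ ball R} := by
    intro R
    have hb : MeasurableSet (ball R) := Metric.isClosed_closedBall.measurableSet
    rw [Set.ofPred_forall]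
    refine MeasurableSet.iInter fun i => ?_
    have h1 : Measurable fun z : Legs d N => z.1 i := by fun_prop
    have h2 : Measurable fun z : Legs d N => z.2 i := by fun_prop
    exact (h1 hb).inter (h2 hb)
  have hgood : ∀ R, MeasurableSet {z : Legs d N | good R (pts z.1) (pts z.2)} := by
    intro R
    simp only [good, hball]
    exact measurableSet_isCausal.compl.inter
      ((measurableSet_le hmeas.norm measurable_const).inter (hballmeas R))
  have hψmeas : ∀ R, Measurable fun z : Legs d N => ψ R (pts z.1) (pts z.2) := fun R =>
    Measurable.ite (hgood R) (Complex.continuous_conj.measurable.comp hmeas) measurable_const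
  have hψbound : ∀ R A B, ‖ψ R A B‖ ≤ R := by
    intro R A B
    simp only [ψ]
    split_ifs with hg
    · rw [RCLike.norm_conj]; exact hg.2.1
    · simp
  have hψgood : ∀ R A B, ψ R A B ≠ 0 → good R A B := fun R A B hne => by
    by_contra hg
    exact hne (if_neg hg)
  have hprod : ∀ R A B, Γ A B * ψ R A B = ((‖ψ R A B‖ ^ 2 : ℝ) : ℂ) := by
    intro R A B
    simp only [ψ]
    split_ifs with hg
    · rw [RCLike.norm_conj, Complex.mul_conj, Complex.normSq_eq_norm_sq]
    · simp
  have hzero : ∀ R : ℕ, ∀ᵐ z ∂(ref N), ψ R (pts z.1) (pts z.2) = 0 := by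
    intro R
    have hp := h (ψ R) ⟨hψmeas R, ⟨R, hψbound R⟩, ball R, Metric.isBounded_closedBall,
      fun A B hne => (hψgood R A B hne).2.2⟩ fun A B hne => (hψgood R A B hne).1
    have hN : (1 / ((N.factorial : ℂ) ^ 2)) ≠ 0 :=
      one_div_ne_zero (pow_ne_zero _ (Nat.cast_ne_zero.2 N.factorial_ne_zero))
    have hI := (mul_eq_zero.1 hp).resolve_left hN
    simp only [hprod] at hI
    rw [integral_complex_ofReal, Complex.ofReal_eq_zero, integral_eq_zero_iff_of_nonneg] at hI
    · filter_upwards [hI] with z hz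
      simpa using hz
    · exact fun z => sq_nonneg _
    · have hK := (integrable_indicator_iff (hballmeas R)).2
        (hint (ball R) Metric.isBounded_closedBall)
      refine (hK.norm.const_mul (R : ℝ)).mono' ((hψmeas R).norm.pow_const 2).aestronglyMeasurable
        (Eventually.of_forall fun z => ?_)
      rw [Real.norm_of_nonneg (sq_nonneg _)]
      by_cases hne : ψ R (pts z.1) (pts z.2) = 0
      · rw [hne, norm_zero, zero_pow two_ne_zero]
        positivity
      · have hg := hψgood R _ _ hne
        rw [Set.indicator_of_mem (show z ∈ {z : Legs d N | ∀ i, z.1 i ∈ ball R ∧ z.2 i ∈ ball R}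
          from (hball R z).1 hg.2.2), sq]
        have heq : ‖ψ R (pts z.1) (pts z.2)‖ = ‖Γ (pts z.1) (pts z.2)‖ := by
          simp only [ψ, if_pos hg, RCLike.norm_conj]
        rw [heq]
        exact mul_le_mul_of_nonneg_right hg.2.1 (norm_nonneg _)
  filter_upwards [ae_all_iff.2 hzero] with z hz hne
  by_contra hc
  obtain ⟨R₁, hR₁⟩ := exists_nat_ge ‖Γ (pts z.1) (pts z.2)‖
  obtain ⟨R₂, hR₂⟩ := exists_nat_ge ‖z‖
  have hg : good (max R₁ R₂) (pts z.1) (pts z.2) := by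
    refine ⟨hc, hR₁.trans (by exact_mod_cast le_max_left R₁ R₂), (hball _ z).2 fun i => ?_⟩
    have hz' : ‖z‖ ≤ ((max R₁ R₂ : ℕ) : ℝ) := hR₂.trans (by exact_mod_cast le_max_right R₁ R₂)
    simp only [ball, mem_closedBall_zero_iff]
    exact ⟨((norm_le_pi_norm z.1 i).trans (norm_fst_le z)).trans hz',
      ((norm_le_pi_norm z.2 i).trans (norm_snd_le z)).trans hz'⟩
  have := hz (max R₁ R₂)
  simp only [ψ, if_pos hg, map_eq_zero] at this
  exact hne this

theorem IsCausallySupported.pairing_eq_zero {Γ ψ : BoseFun d} (hΓ : IsCausallySupported ref Γ)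
    {N : ℕ} (hN : 1 ≤ N) (hψ : ∀ A B, ψ A B ≠ 0 → ¬ IsCausal A B) :
    pairing ref N Γ ψ = 0 := by
  rw [pairing, integral_eq_zero_of_ae, mul_zero]
  filter_upwards [hΓ N hN] with z hz
  by_contra hne
  obtain ⟨h1, h2⟩ := mul_ne_zero_iff.1 hne
  exact hψ _ _ h2 (hz h1)

/-- A restriction can be moved to the test function, so the flow equation of the full vertex
applies. -/
theorem pairing_closeablePart (N m : ℕ) (Γ ψ : BoseFun d) :
    pairing ref N (closeablePart m Γ) ψ = pairing ref N Γ (closeablePart m ψ) := by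
  simp only [pairing, closeablePart, ite_mul, mul_ite, zero_mul, mul_zero]

theorem IsTest.closeablePart {N : ℕ} {ψ : BoseFun d} (hψ : IsTest N ψ) (m : ℕ) :
    IsTest N (closeablePart m ψ) := by
  classical
  obtain ⟨hmeas, ⟨C, hC⟩, K, hK, hsupp⟩ := hψ
  refine ⟨?_, ⟨C, fun A B => ?_⟩, K, hK, fun A B hne => hsupp A B fun h0 => hne ?_⟩
  · exact Measurable.ite ((measurableSet_isCloseable m).inter
      (measurableSet_isCloseable (m + 1)).compl) hmeas measurable_const
  · simp only [VacuumFRG.closeablePart]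
    split_ifs
    · exact hC A B
    · simpa using (norm_nonneg _).trans (hC A B)
  · simp only [VacuumFRG.closeablePart, h0, ite_self]

variable {P : Regularization d} [∀ N, SigmaFinite (ref N)]

theorem ae_pi_of_forall_ae {r : ℕ} {q : Fin (r + 1) → ℕ} {p : ∀ i, Legs d (q i) → Prop}
    (h : ∀ i, ∀ᵐ z ∂(ref (q i)), p i z) :
    ∀ᵐ z ∂(Measure.pi fun i => ref (q i)), ∀ i, p i (z i) :=
  ae_all_iff.2 fun i => Measure.tendsto_eval_ae_ae.eventually (h i)

theorem line_retarded {k : ℝ} (hk : 0 < k) {r : ℕ} (e i : Fin (r + 1)) (x y : Pt d)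
    (h : x.1 ≤ y.1) : (if i = e then P.Gdot k else P.G k) x y = 0 := by
  split_ifs
  · exact P.Gdot_retarded hk x y h
  · exact P.retarded k hk x y h

/-- The comparison is made diagram by diagram, so no summability of the loop expansion is needed. -/
theorem flowRHS_congr {k : ℝ} {Γ Γ' ψ ψ' : BoseFun d} {N : ℕ}
    (h : ∀ (r : ℕ) (q : Fin (r + 1) → ℕ), ∑ i, q i = N + (r + 1) →
      ∀ l ρ : ∀ i, Fin (q i) ⊕ Fin (q i), (∀ i, l i ≠ ρ i) → ∀ e,
        loopDiagram P ref k Γ ψ r q l ρ e = loopDiagram P ref k Γ' ψ' r q l ρ e) :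
    flowRHS P ref k Γ N ψ = flowRHS P ref k Γ' N ψ' := by
  unfold flowRHS
  refine tsum_congr fun r => ?_
  refine congrArg (HMul.hMul _) ?_
  refine Finset.sum_congr rfl fun q hq => ?_
  refine congrArg (HMul.hMul _) ?_
  refine Finset.sum_congr rfl fun l _ => Finset.sum_congr rfl fun ρ _ => ?_
  split_ifs with hlρ
  · exact Finset.sum_congr rfl fun e _ => h r q (Finset.mem_piAntidiag.1 hq).1 l ρ hlρ e
  · rfl

/-- The flow does not generate vertices outside the causal configurations. -/
theorem flowRHS_eq_zero_of_not_isCausal {k : ℝ} (hk : 0 < k) {Γ ψ : BoseFun d} {N : ℕ}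
    (hΓ : IsCausallySupported ref Γ) (hψ : ∀ A B, ψ A B ≠ 0 → ¬ IsCausal A B) :
    flowRHS P ref k Γ N ψ = 0 := by
  have h0 : flowRHS P ref k Γ N 0 = 0 := by simp [flowRHS, loopDiagram]
  rw [← h0]
  refine flowRHS_congr fun r q hq l ρ hlρ e => integral_congr_ae ?_
  -- A vertex in a loop carries an internal leg, so it has at least one body and causal support is
  -- available for it.
  filter_upwards [ae_pi_of_forall_ae fun i => hΓ (q i) (one_le_of_leg (l i))] with z hz
  by_contra hne
  simp only [Pi.zero_apply, mul_zero] at hne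
  obtain ⟨⟨h1, h2⟩, h3⟩ := mul_ne_zero_iff.1 hne |>.imp_left mul_ne_zero_iff.1
  rw [Finset.prod_ne_zero_iff] at h1 h2
  exact hψ _ _ h3 (isCausal_ext hlρ (line_retarded hk e) (fun i => h2 i (Finset.mem_univ i))
    fun i => hz i (h1 i (Finset.mem_univ i)))

/-- The integrands agree almost everywhere: either a factor common to both sides or a vertex
vanishes, or `relevantPart_eq_of_loop` applies to all vertices. -/
theorem flowRHS_relevantPart {k : ℝ} (hk : 0 < k) {Γ : BoseFun d} {n m : ℕ}
    (hΓ : IsCausallySupported ref Γ) (ψ : BoseFun d) :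
    flowRHS P ref k (relevantPart n m Γ) (n + m) (closeablePart m ψ) =
      flowRHS P ref k Γ (n + m) (closeablePart m ψ) := by
  refine flowRHS_congr fun r q hq l ρ hlρ e => integral_congr_ae ?_
  filter_upwards [ae_pi_of_forall_ae fun i => hΓ (q i) (one_le_of_leg (l i))] with z hz
  by_cases hm : IsCloseable m (extOut l ρ z) (extIn l ρ z)
  swap
  · have : closeablePart m ψ (extOut l ρ z) (extIn l ρ z) = 0 := if_neg fun h => hm h.1
    simp only [this, mul_zero]
  by_cases hline : ∀ i, lineFactor (if i = e then P.Gdot k else P.G k) (z i) (z (i + 1))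
      (ρ i) (l (i + 1)) ≠ 0
  swap
  · obtain ⟨i, hi⟩ := not_forall.1 hline
    have hp : ∏ i, lineFactor (if i = e then P.Gdot k else P.G k) (z i) (z (i + 1))
        (ρ i) (l (i + 1)) = 0 := Finset.prod_eq_zero (Finset.mem_univ i) (not_not.1 hi)
    simp only [hp, mul_zero, zero_mul]
  by_cases hv : ∀ i, Γ (pts (z i).1) (pts (z i).2) ≠ 0
  swap
  · obtain ⟨i, hi⟩ := not_forall.1 hv
    have hi := not_not.1 hi
    have hi' : relevantPart n m Γ (pts (z i).1) (pts (z i).2) = 0 := by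
      simp only [relevantPart, hi, ite_self]
    have hp : ∏ i, Γ (pts (z i).1) (pts (z i).2) = 0 :=
      Finset.prod_eq_zero (Finset.mem_univ i) hi
    have hp' : ∏ i, relevantPart n m Γ (pts (z i).1) (pts (z i).2) = 0 :=
      Finset.prod_eq_zero (Finset.mem_univ i) hi'
    simp only [hp, hp', zero_mul]
  simp only [relevantPart_eq_of_loop hlρ (line_retarded hk e) hline (fun i => hz i (hv i)) hq hm Γ]

theorem flowRHS_congr_ae {k : ℝ} {Γ Γ' : BoseFun d} {N : ℕ} (ψ : BoseFun d)
    (h : ∀ q, ∀ᵐ z ∂(ref q), Γ (pts z.1) (pts z.2) = Γ' (pts z.1) (pts z.2)) :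
    flowRHS P ref k Γ N ψ = flowRHS P ref k Γ' N ψ := by
  refine flowRHS_congr fun r q _ l ρ _ e => integral_congr_ae ?_
  filter_upwards [ae_pi_of_forall_ae fun i => h (q i)] with z hz
  simp only [hz]

/-- Causal support is equivalent to vanishing against test functions off the causal set, a linear
condition that is stable under flow steps and weak limits. -/
theorem FlowGenerated.isCausallySupported {S Γ : BoseFun d} (hS : IsMicroscopic ref S)
    (hΓ : FlowGenerated P ref S Γ) : IsCausallySupported ref Γ := by
  induction hΓ with
  | micro =>
    intro N _
    refine Eventually.of_forall fun z hz => ?_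
    obtain ⟨hAB, h2, t, ht⟩ := hS.instantaneous _ _ hz
    exact isCausal_of_instantaneous hAB h2 ht
  | step Γ Γ' k ε hk _ hΓ' hstep ih =>
    intro N hN
    refine ae_isCausal_of_pairing_eq_zero hΓ' fun ψ hψ hc => ?_
    rw [hstep N hN ψ hψ, ih.pairing_eq_zero hN hc, flowRHS_eq_zero_of_not_isCausal hk ih hc,
      mul_zero, add_zero]
  | limit Γs Γ _ hΓ hlim ih =>
    intro N hN
    refine ae_isCausal_of_pairing_eq_zero hΓ fun ψ hψ hc => ?_
    refine tendsto_nhds_unique (hlim N hN ψ hψ) ?_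
    simp only [fun i => (ih i).pairing_eq_zero hN hc]
    exact tendsto_const_nhds

end Flow

end VacuumFRG

theorem theorem1 {d : ℕ} (P : VacuumFRG.Regularization d)
    (ref : ∀ N, MeasureTheory.Measure (VacuumFRG.Legs d N))
    [∀ N, MeasureTheory.SigmaFinite (ref N)]
    (n m : ℕ) (hnm : 1 ≤ n + m) :
    -- the flow equation of the `m`-closeable part of the `(n + m)`-body vertex
    (∀ (S : VacuumFRG.BoseFun d) (Γ : ℝ → VacuumFRG.BoseFun d), VacuumFRG.IsFlow P ref S Γ →
      ∀ k, 0 < k → ∀ ψ, VacuumFRG.IsTest (n + m) ψ →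
        HasDerivAt
          (fun κ => VacuumFRG.pairing ref (n + m) (VacuumFRG.closeablePart m (Γ κ)) ψ)
          (VacuumFRG.flowRHS P ref k (VacuumFRG.relevantPart n m (Γ k)) (n + m)
            (VacuumFRG.closeablePart m ψ)) k) ∧
    -- its right-hand side is the same for any two families of vertices that share these parts
    (∀ S S' Γ Γ' : VacuumFRG.BoseFun d,
      VacuumFRG.IsMicroscopic ref S → VacuumFRG.FlowGenerated P ref S Γ →
      VacuumFRG.IsMicroscopic ref S' → VacuumFRG.FlowGenerated P ref S' Γ' →
      (∀ q, ∀ᵐ z ∂(ref q),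
        VacuumFRG.relevantPart n m Γ (VacuumFRG.pts z.1) (VacuumFRG.pts z.2) =
          VacuumFRG.relevantPart n m Γ' (VacuumFRG.pts z.1) (VacuumFRG.pts z.2)) →
      ∀ k, 0 < k → ∀ ψ, VacuumFRG.IsTest (n + m) ψ →
        VacuumFRG.flowRHS P ref k Γ (n + m) (VacuumFRG.closeablePart m ψ) =
          VacuumFRG.flowRHS P ref k Γ' (n + m) (VacuumFRG.closeablePart m ψ)) := by
  refine ⟨fun S Γ hΓ k hk ψ hψ => ?_, fun S S' Γ Γ' hS hΓ hS' hΓ' h k hk ψ hψ => ?_⟩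
  · rw [VacuumFRG.flowRHS_relevantPart hk
      ((hΓ.generated k hk).isCausallySupported hΓ.isMicroscopic)]
    simp only [VacuumFRG.pairing_closeablePart]
    exact hΓ.flow (n + m) hnm _ (hψ.closeablePart m) k hk
  · rw [← VacuumFRG.flowRHS_relevantPart hk (hΓ.isCausallySupported hS),
      ← VacuumFRG.flowRHS_relevantPart hk (hΓ'.isCausallySupported hS')]
    exact VacuumFRG.flowRHS_congr_ae _ h
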